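/- A JB-algebra is a real Banach space $A$ with a unital, commutative, bilinear (not necessarily associative) product $*$ satisfying the Jordan identity $(a*b)*a^2=a*(b*a^2)$, where $a^2=a*a$, and such that $\|a*b\|\le\|a\|\|b\|$, $\|a^2\|=\|a\|^2$ and $\|a^2\|\le\|a^2+b^2\|$ for all $a,b\in A$. It is ordered by $a\le b$ iff $b-a$ is a square. A normal state of $A$ is a positive linear functional $\omega:A\to\mathbb R$ with $\omega(\bigvee S)=\bigvee\omega(S)$ for every non-empty directed set $S\subseteq A$ that has a supremum. A JBW-algebra is a JB-algebra in which every non-empty directed set that is bounded above has a supremum and whose normal states separate points. Its weak topology is the coarsest topology for which every element of the linear span of the normal states is continuous. For $a\in A$, let $C(a)$ be the norm closure of the subalgebra generated by $a$ and $1$, and let $W(a)$ be the weak closure of $C(a)$. Two elements $a,b\in A$ operator commute if $T_aT_b=T_bT_a$, where $T_a(c)=a*c$. **Proposition.** Let $A$ be a JBW-algebra and let $a,b\in A$ be arbitrary. If $b$ operator commutes with $a$ and with $a^2$, then $b^2$ operator commutes with $a$, and there is an associative subalgebra $B\subseteq A$, any two elements of which operator commute (in $A$), such that $W(a)\subseteq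 B$ and $W(b)\subseteq B$. -/

import Mathlib

/-- A unital, commutative, not necessarily associative ring with a submultiplicative norm
inducing its metric. -/
class NonAssocNormedCommRing (A : Type*) extends Norm A, NonAssocCommRing A, MetricSpace A where
  dist_eq : ∀ x y : A, dist x y = ‖-x + y‖
  norm_mul_le : ∀ x y : A, ‖x * y‖ ≤ ‖x‖ * ‖y‖

instance (priority := 100) NonAssocNormedCommRing.toNormedAddCommGroup (A : Type*)
    [h : NonAssocNormedCommRing A] : NormedAddCommGroup A :=
  { h with }

/-- A (unital, real) JB-algebra: a real Banach space with a unital Jordan product, written `*`,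
such that `‖a * b‖ ≤ ‖a‖ ‖b‖`, `‖a²‖ = ‖a‖²` and `‖a²‖ ≤ ‖a² + b²‖`. -/
class JBAlgebra (A : Type*) extends NonAssocNormedCommRing A, CompleteSpace A, NormedSpace ℝ A,
    IsScalarTower ℝ A A, SMulCommClass ℝ A A, IsCommJordan A where
  norm_mul_self : ∀ a : A, ‖a * a‖ = ‖a‖ ^ 2
  norm_mul_self_le : ∀ a b : A, ‖a * a‖ ≤ ‖a * a + b * b‖

namespace JBAlgebra

variable {A : Type*} [JBAlgebra A]

/-- `a` and `b` operator commute: `T_a T_b = T_b T_a`, where `T_a x = a * x`. -/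
def OperatorCommute (a b : A) : Prop :=
  Commute (LinearMap.mulLeft ℝ a) (LinearMap.mulLeft ℝ b)

/-- The order of a JB-algebra: `a ≤ b` iff `b - a` is positive, that is, a square. -/
def Le (a b : A) : Prop := IsSquare (b - a)

/-- `s` is an upper bound of `S`. -/
def IsUpperBound (S : Set A) (s : A) : Prop := ∀ x ∈ S, Le x s

/-- `s` is the supremum of `S`. -/
def IsSup (S : Set A) (s : A) : Prop :=
  IsUpperBound S s ∧ ∀ u : A, IsUpperBound S u → Le s u

/-- A normal state: a positive linear functional that preserves the suprema of
(nonempty) directed sets. No normalization at the unit is imposed; the functionals with `ω 1 = 1`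
separate the same points and have the same linear span. -/
structure IsNormalState (ω : Module.Dual ℝ A) : Prop where
  nonneg : ∀ a : A, IsSquare a → 0 ≤ ω a
  normal : ∀ (S : Set A) (s : A), S.Nonempty → DirectedOn Le S → IsSup S s → IsLUB (ω '' S) (ω s)

variable (A) in
/-- The linear span `V` of the normal states. -/
def normalDual : Submodule ℝ (Module.Dual ℝ A) :=
  Submodule.span ℝ {ω | IsNormalState ω}

variable (A) in
/-- The weak topology `σ(A, V)`: the coarsest topology making every functional in the span `V` of
the normal states continuous. -/
@[reducible] def weakTopology : TopologicalSpace A :=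
  ⨅ ω ∈ normalDual A, TopologicalSpace.induced (fun a : A => ω a) inferInstance

/-- The Jordan algebra `J(a)` generated by `a` (and the unit), i.e. the polynomials in `a`. -/
def J (a : A) : NonUnitalSubalgebra ℝ A := NonUnitalAlgebra.adjoin ℝ {1, a}

/-- The norm closure `C(a)` of `J(a)`. -/
def C (a : A) : Set A := closure (J a : Set A)

/-- The weak closure `W(a)` of `C(a)`. -/
def W (a : A) : Set A := @closure A (weakTopology A) (C a)

end JBAlgebra

/-- A JBW-algebra: a JB-algebra that is bounded directed-complete and has a separating set of
normal states. -/
class JBWAlgebra (A : Type*) extends JBAlgebra A where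
  exists_isSup : ∀ S : Set A, S.Nonempty → DirectedOn JBAlgebra.Le S →
    (∃ u : A, JBAlgebra.IsUpperBound S u) → ∃ s : A, JBAlgebra.IsSup S s
  eq_of_normalState : ∀ a b : A,
    (∀ ω : Module.Dual ℝ A, JBAlgebra.IsNormalState ω → ω a = ω b) → a = b

/-!
Write `T_a` for the multiplication by `a`. The heart of the matter is that `b * b` operator commutes
with `a` as soon as `b` operator commutes with `a` and `a * a`
(`JBAlgebra.OperatorCommute.mul_self_left`). The operator `D = [T_a, T_{b * b}]` is a derivation,
and the hypotheses give `D a = D b = 0`; hence `D` commutes with both `T_a` and `T_{b * b}`. By the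
argument of Kleinecke and Shirokov, `n ! ‖D ^ n‖ ≤ C ^ n`, so that `exp (z D)` is entire of order at
most `1 / 2` in `z`. On the real line it consists of automorphisms, which are contractive because
`‖x * x‖ = ‖x‖ ^ 2`. By Phragmén–Lindelöf and Liouville it is constant, and `D = 0`
(`JBAlgebra.derivation_eq_zero_of_commutator`). No spectral theory is needed.

Consequently the operator commutant of a set closed under squares is a subalgebra, and the
bicommutant of a pairwise operator commuting set closed under squares is a subalgebra of pairwise
operator commuting elements; such a subalgebra is associative. The powers of `a` and `b` form such
a set, by the triple product formula `JBAlgebra.mul_mul_mul_eq` for multiplication operators, and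
`B` is its bicommutant.

It remains to see that `B` is weakly closed, for which the multiplications have to be weakly
continuous. Since `T_c` is a linear combination of the quadratic maps `U_{1 + 2 c}`, `U_{1 + c}` and
the identity, it is enough that `U_{1 + c}` is an order isomorphism for small `c`: it then preserves
suprema, and the composition of a normal state with it is a positive normal functional. The inverse
of `U_{1 + c}` is `U_{(1 + c)⁻¹}`, and positivity (`JBAlgebra.isSquare_quad_one_add`) follows from a
differential equation `y' = 2 T_d y` for `y = U_{1 + t c} x`, since a positive functional that
annihilates a positive `y` annihilates `d * y`. The facts about the cone of squares that enter here
rest on the existence of a square root of `1 - y` for `‖y‖ ≤ 1`, obtained by iteration.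
-/

namespace JBAlgebra

variable {A : Type*} [JBAlgebra A]

/-! ### Operator commutation and inner derivations -/

lemma operatorCommute_iff {a b : A} :
    OperatorCommute a b ↔ ∀ x, a * (b * x) = b * (a * x) := by
  constructor
  · intro h x
    exact LinearMap.congr_fun h x
  · intro h
    exact LinearMap.ext h

lemma OperatorCommute.symm {a b : A} (h : OperatorCommute a b) : OperatorCommute b a :=
  Commute.symm h

lemma OperatorCommute.apply {a b : A} (h : OperatorCommute a b) (x : A) :
    a * (b * x) = b * (a * x) :=
  operatorCommute_iff.1 h x

/-- The full linearization of the Jordan identity. -/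
lemma linearized_jordan (a b c x : A) :
    a * (b * c * x) - b * c * (a * x) + (b * (c * a * x) - c * a * (b * x))
      + (c * (a * b * x) - a * b * (c * x)) = 0 := by
  have h := DFunLike.congr_fun (two_nsmul_lie_lmul_lmul_add_add_eq_zero a b c) x
  change 2 • (a * (b * c * x) - b * c * (a * x) + (b * (c * a * x) - c * a * (b * x))
      + (c * (a * b * x) - a * b * (c * x))) = 0 at h
  rw [← Nat.cast_smul_eq_nsmul ℝ] at h
  simpa only [Nat.cast_ofNat, smul_eq_zero, OfNat.ofNat_ne_zero, false_or] using h

/-- The expression of the multiplication by a triple product through multiplications by its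
factors and their products. -/
lemma mul_mul_mul_eq (a b c x : A) :
    (b * c * a) * x = b * c * (a * x) + b * a * (c * x) + c * a * (b * x)
      - b * (a * (c * x)) - c * (a * (b * x)) := by
  have h := linearized_jordan x b c a
  have e1 : x * (b * c * a) = (b * c * a) * x := mul_comm _ _
  have e2 : x * a = a * x := mul_comm _ _
  have e3 : c * x * a = a * (c * x) := mul_comm _ _
  have e4 : c * x * (b * a) = b * a * (c * x) := mul_comm _ _
  have e5 : x * b * a = a * (b * x) := by rw [mul_comm, mul_comm x b]
  have e6 : x * b * (c * a) = c * a * (b * x) := by rw [mul_comm, mul_comm x b]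
  rw [e1, e2, e3, e4, e5, e6] at h
  rw [← sub_eq_zero, ← h]
  abel

/-- The commutator of two multiplication operators is a derivation. -/
lemma commutator_mul (a b x y : A) :
    a * (b * (x * y)) - b * (a * (x * y)) =
      (a * (b * x) - b * (a * x)) * y + x * (a * (b * y) - b * (a * y)) := by
  have h1 := mul_mul_mul_eq a b x y
  have h2 := mul_mul_mul_eq b a x y
  have e1 : b * x * a = a * (b * x) := mul_comm _ _
  have e2 : a * x * b = b * (a * x) := mul_comm _ _
  rw [e1] at h1
  rw [e2] at h2
  rw [sub_mul, mul_sub, h1, h2, mul_comm b a, mul_comm x b, mul_comm x a]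
  abel

/-- The multiplication by `a`, as a bounded operator. -/
noncomputable def mulL (a : A) : A →L[ℝ] A :=
  (LinearMap.mulLeft ℝ a).mkContinuous ‖a‖ (NonAssocNormedCommRing.norm_mul_le a)

@[simp] lemma mulL_apply (a x : A) : mulL a x = a * x := rfl

lemma operatorCommute_iff_mulL {a b : A} : OperatorCommute a b ↔ Commute (mulL a) (mulL b) := by
  rw [operatorCommute_iff]
  exact ⟨fun h => ContinuousLinearMap.ext h, fun h x => congr($h x)⟩

lemma isBoundedBilinearMap_mul : IsBoundedBilinearMap ℝ (fun p : A × A => p.1 * p.2) where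
  add_left := add_mul
  smul_left c x y := smul_mul_assoc c x y
  add_right x y z := mul_add x y z
  smul_right c x y := mul_smul_comm c x y
  bound := ⟨1, one_pos, fun x y => by simpa using NonAssocNormedCommRing.norm_mul_le x y⟩

instance : ContinuousMul A := ⟨isBoundedBilinearMap_mul.continuous⟩

lemma hasDerivAt_mul {u v : ℝ → A} {u' v' : A} {t : ℝ} (hu : HasDerivAt u u' t)
    (hv : HasDerivAt v v' t) : HasDerivAt (fun t => u t * v t) (u' * v t + u t * v') t := by
  have h := (isBoundedBilinearMap_mul.hasFDerivAt (u t, v t)).comp_hasDerivAt t (hu.prodMk hv)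
  exact h.congr_deriv (add_comm _ _)

end JBAlgebra

section

open Complex Set Filter Asymptotics Bornology

/-! ### Entire functions of order less than one -/

lemma summable_sq_pow_div_factorial (s : ℝ) :
    Summable fun n : ℕ => (s ^ n / n.factorial) ^ 2 := by
  refine Summable.of_nonneg_of_le (fun n => sq_nonneg _) (fun n => ?_)
    (Real.summable_pow_div_factorial (s ^ 2))
  rw [div_pow, ← pow_mul, ← pow_mul, mul_comm n 2]
  have h1 : (1 : ℝ) ≤ n.factorial := by exact_mod_cast Nat.one_le_iff_ne_zero.2 n.factorial_ne_zero
  have h0 : 0 ≤ s ^ (2 * n) := by rw [pow_mul]; positivity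
  exact div_le_div_of_nonneg_left h0 (by positivity) (by nlinarith)

lemma tsum_sq_pow_div_factorial_le {s : ℝ} (hs : 0 ≤ s) :
    ∑' n : ℕ, (s ^ n / n.factorial) ^ 2 ≤ Real.exp (2 * s) := by
  have hsum := summable_sq_pow_div_factorial s
  have h2 : Real.exp (2 * s) = Real.exp s ^ 2 := by rw [two_mul, Real.exp_add, sq]
  have hs' : Summable fun n : ℕ => s ^ n / n.factorial := Real.summable_pow_div_factorial s
  rw [h2]
  refine hsum.tsum_le_of_sum_range_le (fun n => ?_)
  calc ∑ i ∈ Finset.range n, (s ^ i / i.factorial) ^ 2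
      ≤ (∑ i ∈ Finset.range n, s ^ i / i.factorial) ^ 2 :=
        Finset.sum_sq_le_sq_sum_of_nonneg (fun i _ => by positivity)
    _ ≤ Real.exp s ^ 2 := by
        gcongr
        exact Real.sum_le_exp_of_nonneg hs n

/-- A power series in `t` whose coefficients decay like `1 / (n !) ^ 2` and whose sum is bounded on
the real line is constant there. After the substitution `t = w ^ 2` it is an entire function of
exponential type, bounded on both axes, so that the Phragmén–Lindelöf principle in the four
quadrants and Liouville's theorem apply. -/
lemma tsum_eq_of_bounded_of_factorial_decay {a : ℕ → ℝ} {K s M : ℝ} (hs : 0 ≤ s)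
    (ha : ∀ n, |a n| ≤ K * (s ^ n / n.factorial) ^ 2) (hM : ∀ t : ℝ, |∑' n, a n * t ^ n| ≤ M)
    {t : ℝ} (ht : 0 ≤ t) : ∑' n, a n * t ^ n = a 0 := by
  have hK : 0 ≤ K := by simpa using (abs_nonneg _).trans (ha 0)
  set F : ℕ → ℂ → ℂ := fun n w => (a n : ℂ) * (w ^ 2) ^ n with hF
  set g : ℂ → ℂ := fun w => ∑' n, F n w with hg
  have hFb : ∀ (R : ℝ) (n : ℕ) (w : ℂ), ‖w‖ ≤ R → ‖F n w‖ ≤ K * ((s * R) ^ n / n.factorial) ^ 2 := by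
    intro R n w hw
    simp only [hF, norm_mul, norm_pow, Complex.norm_real, Real.norm_eq_abs]
    have h1 : (‖w‖ ^ 2) ^ n ≤ (R ^ 2) ^ n := by gcongr
    calc |a n| * (‖w‖ ^ 2) ^ n ≤ (K * (s ^ n / n.factorial) ^ 2) * (R ^ 2) ^ n := by
          gcongr
          exact ha n
      _ = _ := by rw [mul_pow]; ring
  have hsumm : ∀ R : ℝ, Summable fun n : ℕ => K * ((s * R) ^ n / n.factorial) ^ 2 :=
    fun R => (summable_sq_pow_div_factorial _).mul_left K
  have hd : Differentiable ℂ g := by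
    intro w
    have hdo : DifferentiableOn ℂ g (Metric.ball 0 (‖w‖ + 1)) := by
      refine differentiableOn_tsum_of_summable_norm (hsumm (‖w‖ + 1)) (fun n => ?_)
        Metric.isOpen_ball (fun n z hz => hFb _ n z ?_)
      · exact (((differentiable_id.pow 2).pow n).const_mul _).differentiableOn
      · exact (mem_ball_zero_iff.1 hz).le
    exact hdo.differentiableAt (Metric.isOpen_ball.mem_nhds (by simp))
  have hgrow : ∀ w, ‖g w‖ ≤ K * Real.exp (2 * (s * ‖w‖)) := by
    intro w
    calc ‖g w‖ ≤ ∑' n : ℕ, K * ((s * ‖w‖) ^ n / n.factorial) ^ 2 :=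
          tsum_of_norm_bounded (hsumm ‖w‖).hasSum (fun n => hFb _ n w le_rfl)
      _ = K * ∑' n : ℕ, ((s * ‖w‖) ^ n / n.factorial) ^ 2 := tsum_mul_left
      _ ≤ _ := by
        gcongr
        exact tsum_sq_pow_div_factorial_le (by positivity)
  have hreal : ∀ (w : ℂ) (r : ℝ), w ^ 2 = r → g w = ((∑' n, a n * r ^ n : ℝ) : ℂ) := by
    intro w r hw
    simp only [hg, hF, hw]
    push_cast
    rfl
  have hre : ∀ x : ℝ, ‖g x‖ ≤ M := by
    intro x
    rw [hreal x (x ^ 2) (by push_cast; rfl), Complex.norm_real]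
    exact hM _
  have him : ∀ x : ℝ, ‖g (x * I)‖ ≤ M := by
    intro x
    rw [hreal (x * I) (-x ^ 2) (by push_cast; rw [mul_pow, I_sq]; ring), Complex.norm_real]
    exact hM _
  have hB : ∀ S : Set ℂ, ∃ c < (2 : ℝ), ∃ B,
      g =O[cobounded ℂ ⊓ 𝓟 S] fun z => Real.exp (B * ‖z‖ ^ c) := by
    intro S
    refine ⟨1, by norm_num, 2 * s, ?_⟩
    refine IsBigO.of_bound K (Eventually.of_forall fun w => ?_)
    rw [Real.rpow_one, Real.norm_eq_abs, Real.abs_exp, mul_assoc]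
    exact hgrow w
  have hbd : ∀ w, ‖g w‖ ≤ M := by
    intro w
    rcases le_total 0 w.re with h1 | h1 <;> rcases le_total 0 w.im with h2 | h2
    · exact PhragmenLindelof.quadrant_I hd.diffContOnCl (hB _) (fun x _ => hre x)
        (fun x _ => him x) h1 h2
    · exact PhragmenLindelof.quadrant_IV hd.diffContOnCl (hB _) (fun x _ => hre x)
        (fun x _ => him x) h1 h2
    · exact PhragmenLindelof.quadrant_II hd.diffContOnCl (hB _) (fun x _ => hre x)
        (fun x _ => him x) h1 h2
    · exact PhragmenLindelof.quadrant_III hd.diffContOnCl (hB _) (fun x _ => hre x)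
        (fun x _ => him x) h1 h2
  have hconst := hd.apply_eq_apply_of_bounded
    (isBounded_iff_forall_norm_le.2 ⟨M, by rintro _ ⟨w, rfl⟩; exact hbd w⟩) (√t : ℝ) 0
  rw [hreal _ t (by rw [← Complex.ofReal_pow, Real.sq_sqrt ht]), hreal 0 0 (by simp)] at hconst
  rw [Complex.ofReal_inj.1 hconst, tsum_eq_single 0 (fun n hn => by simp [hn])]
  simp

end

section

open NormedSpace

/-! ### Quasinilpotent derivations -/

section KleineckeShirokov

variable {R : Type*}

lemma commutator_pow_succ [Ring R] {X Y D : R} (hD : X * Y - Y * X = D) (hY : Commute D Y)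
    (m : ℕ) : X * Y ^ (m + 1) - Y ^ (m + 1) * X = (m + 1) • (D * Y ^ m) := by
  induction m with
  | zero => simp [hD]
  | succ m ih =>
    have h1 : X * Y ^ (m + 1 + 1) - Y ^ (m + 1 + 1) * X =
        (X * Y ^ (m + 1) - Y ^ (m + 1) * X) * Y + Y ^ (m + 1) * (X * Y - Y * X) := by
      rw [pow_succ Y (m + 1)]; noncomm_ring
    rw [h1, ih, hD, ← (hY.pow_right (m + 1)).eq, smul_mul_assoc, mul_assoc, ← pow_succ,
      succ_nsmul _ (m + 1)]

/-- If `D = [X, Y]` commutes with `X` and `Y`, then `ad_X ^ k (Y ^ (n + k))` is a multiple of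
`D ^ k * Y ^ n`; in particular `ad_X ^ k (Y ^ k) = k ! D ^ k`. -/
lemma iterate_commutator_pow [Ring R] {X Y D : R} (hD : X * Y - Y * X = D) (hX : Commute D X)
    (hY : Commute D Y) (k n : ℕ) :
    (fun Z => X * Z - Z * X)^[k] (Y ^ (n + k)) = (n + k).descFactorial k • (D ^ k * Y ^ n) := by
  induction k generalizing n with
  | zero => simp
  | succ k ih =>
    have h1 : n + (k + 1) = n + 1 + k := by omega
    rw [Function.iterate_succ_apply', h1, ih, Nat.descFactorial_succ, Nat.add_sub_cancel,
      mul_comm (n + 1), mul_smul]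
    have h2 : X * (D ^ k * Y ^ (n + 1)) - D ^ k * Y ^ (n + 1) * X =
        D ^ k * (X * Y ^ (n + 1) - Y ^ (n + 1) * X) := by
      rw [mul_sub, ← mul_assoc, ← (hX.pow_left k).eq, mul_assoc, mul_assoc]
    rw [mul_smul_comm, smul_mul_assoc, ← smul_sub, h2, commutator_pow_succ hD hY, mul_smul_comm,
      ← mul_assoc, ← pow_succ]

/-- The quantitative form of the Kleinecke–Shirokov theorem. -/
lemma factorial_mul_norm_commutator_pow_le [NormedRing R] [NormedAlgebra ℝ R] {X Y D : R}
    (hD : X * Y - Y * X = D) (hX : Commute D X) (hY : Commute D Y) (n : ℕ) (hn : n ≠ 0) :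
    n.factorial * ‖D ^ n‖ ≤ (2 * ‖X‖ * ‖Y‖) ^ n := by
  have h := iterate_commutator_pow hD hX hY n 0
  rw [zero_add, Nat.descFactorial_self, pow_zero, mul_one] at h
  have hb : ∀ (k : ℕ) (Z : R), ‖(fun Z => X * Z - Z * X)^[k] Z‖ ≤ (2 * ‖X‖) ^ k * ‖Z‖ := by
    intro k Z
    induction k with
    | zero => simp
    | succ k ih =>
      rw [Function.iterate_succ_apply']
      set V := (fun Z => X * Z - Z * X)^[k] Z
      calc ‖X * V - V * X‖ ≤ ‖X‖ * ‖V‖ + ‖V‖ * ‖X‖ :=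
            (norm_sub_le _ _).trans (add_le_add (norm_mul_le _ _) (norm_mul_le _ _))
        _ = 2 * ‖X‖ * ‖V‖ := by ring
        _ ≤ 2 * ‖X‖ * ((2 * ‖X‖) ^ k * ‖Z‖) := by gcongr
        _ = _ := by ring
  calc (n.factorial : ℝ) * ‖D ^ n‖ = ‖(n.factorial : ℝ) • D ^ n‖ := by rw [norm_smul]; simp
    _ = ‖(fun Z => X * Z - Z * X)^[n] (Y ^ n)‖ := by rw [h, Nat.cast_smul_eq_nsmul]
    _ ≤ (2 * ‖X‖) ^ n * ‖Y ^ n‖ := hb n _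
    _ ≤ (2 * ‖X‖) ^ n * ‖Y‖ ^ n := by gcongr; exact norm_pow_le' _ (Nat.pos_of_ne_zero hn)
    _ = _ := (mul_pow _ _ _).symm

end KleineckeShirokov

namespace JBAlgebra

variable {A : Type*} [JBAlgebra A]

lemma hasDerivAt_exp_smul_apply (D : A →L[ℝ] A) (x : A) (t : ℝ) :
    HasDerivAt (fun t : ℝ => exp (t • D) x) (D (exp (t • D) x)) t := by
  have h := (hasDerivAt_exp_smul_const' D t).clm_apply (hasDerivAt_const t x)
  simpa using h

lemma exp_neg_smul_apply_exp (D : A →L[ℝ] A) (x : A) (t : ℝ) :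
    exp ((-t) • D) (exp (t • D) x) = x := by
  let _ : NormedAlgebra ℚ (A →L[ℝ] A) := NormedAlgebra.restrictScalars ℚ ℝ _
  have h : exp ((-t) • D) * exp (t • D) = 1 := by
    rw [← exp_add_of_commute (((Commute.refl D).smul_left _).smul_right _), ← add_smul]
    simp
  exact congr($h x)

/-- The one-parameter group generated by a bounded derivation consists of automorphisms. -/
lemma exp_derivation_mul {D : A →L[ℝ] A} (hD : ∀ x y, D (x * y) = D x * y + x * D y)
    (x y : A) (t : ℝ) : exp (t • D) (x * y) = exp (t • D) x * exp (t • D) y := by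
  set G : ℝ → A := fun t => exp ((-t) • D) (exp (t • D) x * exp (t • D) y) with hG
  have hd : ∀ t, HasDerivAt G 0 t := by
    intro t
    have h1 : HasDerivAt (fun t : ℝ => exp ((-t) • D)) (-(exp ((-t) • D) * D)) t := by
      have := (hasDerivAt_exp_smul_const D (-t)).scomp t (hasDerivAt_neg t)
      simpa [Function.comp_def] using this
    have h2 := hasDerivAt_mul (hasDerivAt_exp_smul_apply D x t) (hasDerivAt_exp_smul_apply D y t)
    refine (h1.clm_apply h2).congr_deriv ?_
    rw [← hD]
    simp
  have hc := is_const_of_deriv_eq_zero (fun t => (hd t).differentiableAt)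
    (fun t => (hd t).deriv) t 0
  have h0 : G 0 = x * y := by simp [hG]
  rw [h0] at hc
  have := exp_neg_smul_apply_exp D (exp (t • D) x * exp (t • D) y) (-t)
  rw [neg_neg] at this
  rw [← hc, this]

/-- Bounded multiplicative maps of a JB-algebra are contractive, because the norm satisfies
`‖x * x‖ = ‖x‖ ^ 2`. -/
lemma norm_apply_le_of_map_mul {E : A →L[ℝ] A} (hE : ∀ x y, E (x * y) = E x * E y) (x : A) :
    ‖E x‖ ≤ ‖x‖ := by
  have h1 : ∀ (n : ℕ) (x : A), ‖E x‖ ^ 2 ^ n ≤ ‖E‖ * ‖x‖ ^ 2 ^ n := by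
    intro n
    induction n with
    | zero => intro x; simpa using E.le_opNorm x
    | succ n ih =>
      intro x
      have h := ih (x * x)
      rwa [hE, norm_mul_self, norm_mul_self, ← pow_mul, ← pow_mul, ← pow_succ'] at h
  by_contra! hlt
  rcases (norm_nonneg x).eq_or_lt with h0 | h0
  · have := h1 0 x
    rw [← h0] at this hlt
    simp at this hlt
    exact hlt this
  · have hq : 1 < ‖E x‖ / ‖x‖ := (one_lt_div h0).2 hlt
    obtain ⟨n, hn⟩ := pow_unbounded_of_one_lt ‖E‖ hq
    have h2 : (‖E x‖ / ‖x‖) ^ n ≤ (‖E x‖ / ‖x‖) ^ 2 ^ n :=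
      pow_le_pow_right₀ hq.le Nat.lt_two_pow_self.le
    have h3 : (‖E x‖ / ‖x‖) ^ 2 ^ n ≤ ‖E‖ := by
      rw [div_pow, div_le_iff₀ (by positivity)]
      exact h1 n x
    linarith

/-- A derivation that is a commutator `[X, Y]` commuting with `X` and `Y` vanishes: it is
quasinilpotent by the Kleinecke–Shirokov theorem, so that the orbits `exp (t D) x`, which are
bounded, extend to entire functions of order at most `1 / 2`, and hence are constant. -/
lemma derivation_eq_zero_of_commutator {X Y D : A →L[ℝ] A} (hXY : X * Y - Y * X = D)
    (hX : Commute D X) (hY : Commute D Y) (hD : ∀ x y, D (x * y) = D x * y + x * D y) : D = 0 := by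
  set c : ℝ := 2 * ‖X‖ * ‖Y‖ with hc
  have hc0 : 0 ≤ c := by positivity
  have hpow : ∀ (n : ℕ) (x : A), ‖(D ^ n) x‖ ≤ c ^ n / n.factorial * ‖x‖ := by
    intro n x
    rcases eq_or_ne n 0 with rfl | hn
    · simp
    · refine ((D ^ n).le_opNorm x).trans ?_
      gcongr
      rw [le_div_iff₀ (by positivity), mul_comm]
      exact factorial_mul_norm_commutator_pow_le hXY hX hY n hn
  have hfix : ∀ (t : ℝ), 0 ≤ t → ∀ x : A, exp (t • D) x = x := by
    intro t ht x
    refine (SeparatingDual.eq_iff_forall_dual_eq (R := ℝ)).2 fun φ => ?_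
    set a : ℕ → ℝ := fun n => (n.factorial : ℝ)⁻¹ * φ ((D ^ n) x) with ha
    have hser : ∀ t : ℝ, HasSum (fun n => a n * t ^ n) (φ (exp (t • D) x)) := by
      intro t
      have h1 := exp_series_hasSum_exp' (𝕂 := ℝ) (t • D)
      have h2 := (h1.mapL (ContinuousLinearMap.apply ℝ A x)).mapL φ
      refine h2.congr_fun ?_
      intro n
      simp [ha, smul_pow]
      ring
    have hM : ∀ t : ℝ, |∑' n, a n * t ^ n| ≤ ‖φ‖ * ‖x‖ := by
      intro t
      rw [(hser t).tsum_eq]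
      refine (φ.le_opNorm _).trans ?_
      gcongr
      exact norm_apply_le_of_map_mul (fun x y => exp_derivation_mul hD x y t) x
    have hbound : ∀ n, |a n| ≤ ‖φ‖ * ‖x‖ * (√c ^ n / n.factorial) ^ 2 := by
      intro n
      rw [ha, abs_mul, abs_of_nonneg (by positivity), div_pow, ← pow_mul, mul_comm n 2, pow_mul,
        Real.sq_sqrt hc0]
      calc (n.factorial : ℝ)⁻¹ * |φ ((D ^ n) x)|
          ≤ (n.factorial : ℝ)⁻¹ * (‖φ‖ * (c ^ n / n.factorial * ‖x‖)) := by
            gcongr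
            refine (φ.le_opNorm _).trans ?_
            gcongr
            exact hpow n x
        _ = _ := by field_simp
    have := tsum_eq_of_bounded_of_factorial_decay (Real.sqrt_nonneg c) hbound hM ht
    rw [(hser t).tsum_eq] at this
    simpa [ha] using this
  have hfix' : ∀ (t : ℝ) (x : A), exp (t • D) x = x := by
    intro t x
    rcases le_total 0 t with ht | ht
    · exact hfix t ht x
    · have h := exp_neg_smul_apply_exp D x (-t)
      rwa [neg_neg, hfix (-t) (by linarith)] at h
  ext x
  have h := hasDerivAt_exp_smul_apply D x 0
  simp only [hfix'] at h
  exact h.unique (hasDerivAt_const 0 x)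

/-- If `b` operator commutes with `a` and with `a * a`, then `b * b` operator commutes with `a`:
the derivation `[T_a, T_{b * b}]` annihilates both `a` and `b`, and therefore commutes with `T_a`
and with `T_{b * b}`. -/
theorem OperatorCommute.mul_self_left {a b : A} (h₁ : OperatorCommute b a)
    (h₂ : OperatorCommute b (a * a)) : OperatorCommute (b * b) a := by
  set D : A →L[ℝ] A := mulL a * mulL (b * b) - mulL (b * b) * mulL a with hDdef
  have hDa : ∀ x, D x = a * (b * b * x) - b * b * (a * x) := fun x => rfl
  have hD : ∀ x y, D (x * y) = D x * y + x * D y := fun x y => by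
    simp only [hDa]; exact commutator_mul a (b * b) x y
  have hbb : ∀ x, b * (b * b * x) = b * b * (b * x) := fun x =>
    DFunLike.congr_fun (commute_lmul_lmul_sq b).eq x
  have D_b : D b = 0 := by
    rw [hDa, mul_comm (b * b) b, ← h₁.apply, mul_comm a b, ← hbb, mul_comm (b * b) a,
      ← h₁.apply, sub_self]
  have D_a : D a = 0 := by
    rw [hDa, mul_comm (b * b) a, ← h₁.apply b, mul_comm a b, ← h₁.apply, ← h₁.apply a,
      mul_comm (b * b), ← h₂.apply, mul_comm (a * a) b, sub_self]
  have D_bb : D (b * b) = 0 := by rw [hD, D_b, zero_mul, mul_zero, add_zero]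
  have hcomm : ∀ y, D y = 0 → Commute D (mulL y) := fun y hy =>
    ContinuousLinearMap.ext fun x => by
      change D (y * x) = y * D x
      rw [hD, hy, zero_mul, zero_add]
  have h0 := derivation_eq_zero_of_commutator rfl (hcomm a D_a) (hcomm _ D_bb) hD
  refine operatorCommute_iff.2 fun x => ?_
  have h := congr($h0 x)
  rw [hDa] at h
  exact (sub_eq_zero.1 h).symm

end JBAlgebra

end

namespace JBAlgebra

variable {A : Type*} [JBAlgebra A]

/-! ### Operator commutants -/

lemma operatorCommute_refl (a : A) : OperatorCommute a a := Commute.refl _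

lemma operatorCommute_mul_self (a : A) : OperatorCommute a (a * a) :=
  operatorCommute_iff.2 fun x => DFunLike.congr_fun (commute_lmul_lmul_sq a).eq x

/-- The set of the elements that operator commute with every element of `S`. -/
def commutant (S : Set A) : Submodule ℝ A where
  carrier := {x | ∀ s ∈ S, OperatorCommute x s}
  zero_mem' s _ := operatorCommute_iff.2 fun x => by simp
  add_mem' {x y} hx hy s hs := operatorCommute_iff.2 fun z => by
    rw [add_mul, add_mul, mul_add, (hx s hs).apply, (hy s hs).apply]
  smul_mem' c x hx s hs := operatorCommute_iff.2 fun z => by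
    rw [smul_mul_assoc, smul_mul_assoc, mul_smul_comm, (hx s hs).apply]

lemma mem_commutant {S : Set A} {x : A} :
    x ∈ commutant S ↔ ∀ s ∈ S, OperatorCommute x s := Iff.rfl

lemma isClosed_commutant (S : Set A) : IsClosed (commutant S : Set A) := by
  have h : (commutant S : Set A) = ⋂ s ∈ S, ⋂ z : A, {x | x * (s * z) = s * (x * z)} := by
    ext x
    simp [mem_commutant, operatorCommute_iff]
  rw [h]
  exact isClosed_biInter fun s _ => isClosed_iInter fun z =>
    isClosed_eq (continuous_id.mul continuous_const)
      (continuous_const.mul (continuous_id.mul continuous_const))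

lemma mul_mem_commutant {S : Set A} (hS : ∀ s ∈ S, s * s ∈ S) {x y : A}
    (hx : x ∈ commutant S) (hy : y ∈ commutant S) : x * y ∈ commutant S := by
  have hsq : ∀ z ∈ commutant S, z * z ∈ commutant S := fun z hz s hs =>
    (hz s hs).mul_self_left (hz _ (hS s hs))
  have h : x * y = (2⁻¹ : ℝ) • ((x + y) * (x + y) - x * x - y * y) := by
    have h1 : (x + y) * (x + y) - x * x - y * y = (2 : ℝ) • (x * y) := by
      rw [add_mul, mul_add, mul_add, mul_comm y x, two_smul]; abel
    rw [h1, smul_smul]; norm_num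
  rw [h]
  exact Submodule.smul_mem _ _ (Submodule.sub_mem _ (Submodule.sub_mem _
    (hsq _ (Submodule.add_mem _ hx hy)) (hsq _ hx)) (hsq _ hy))

/-- The bicommutant of a set that is closed under squares. -/
def bicommutant (S : Set A) (hS : ∀ s ∈ S, s * s ∈ S) : NonUnitalSubalgebra ℝ A :=
  { commutant (commutant S : Set A) with
    mul_mem' := fun hx hy => mul_mem_commutant (S := (commutant S : Set A))
      (fun _ hs => mul_mem_commutant hS hs hs) hx hy }

lemma subset_bicommutant {S : Set A} (hS : ∀ s ∈ S, s * s ∈ S) :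
    S ⊆ (bicommutant S hS : Set A) := fun s hs _ hy => (hy s hs).symm

lemma isClosed_bicommutant {S : Set A} (hS : ∀ s ∈ S, s * s ∈ S) :
    IsClosed (bicommutant S hS : Set A) := isClosed_commutant _

lemma operatorCommute_of_mem_bicommutant {S : Set A} {hS : ∀ s ∈ S, s * s ∈ S}
    (hc : ∀ s ∈ S, ∀ t ∈ S, OperatorCommute s t) {x y : A} (hx : x ∈ bicommutant S hS)
    (hy : y ∈ bicommutant S hS) : OperatorCommute x y :=
  hx y fun s hs => hy s (hc s hs)

/-! ### Powers -/

/-- The powers of `a`, formed as `a * (a * (⋯ * 1))`. -/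
def jpow (a : A) : ℕ → A
  | 0 => 1
  | n + 1 => a * jpow a n

lemma OperatorCommute.jpow_right {x a : A} (h₁ : OperatorCommute x a)
    (h₂ : OperatorCommute x (a * a)) (n : ℕ) : OperatorCommute x (jpow a n) := by
  rw [operatorCommute_iff_mulL] at *
  induction n using Nat.twoStepInduction with
  | zero =>
    have : mulL (1 : A) = 1 := ContinuousLinearMap.ext fun z => one_mul z
    simp [jpow, this]
  | one => simpa [jpow] using h₁
  | more n ih1 ih2 =>
    -- the triple product formula expresses `T_{a * (a * p)}` through `T_a`, `T_{a * a}`, `T_p`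
    -- and `T_{a * p}`
    have h : mulL (jpow a (n + 2)) = mulL (jpow a (n + 1)) * mulL a + mulL (a * a) * mulL (jpow a n)
        + mulL (jpow a (n + 1)) * mulL a - mulL a * (mulL a * mulL (jpow a n))
        - mulL (jpow a n) * (mulL a * mulL a) := by
      ext z
      have := mul_mul_mul_eq a a (jpow a n) z
      rw [mul_comm (a * jpow a n) a, mul_comm (jpow a n) a] at this
      exact this
    rw [h]
    exact ((((ih2.mul_right h₁).add_right (h₂.mul_right ih1)).add_right
      (ih2.mul_right h₁)).sub_right (h₁.mul_right (h₁.mul_right ih1))).sub_right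
      (ih1.mul_right (h₁.mul_right h₁))

lemma operatorCommute_jpow_jpow (a : A) (m n : ℕ) : OperatorCommute (jpow a m) (jpow a n) := by
  have h1 := (operatorCommute_refl a).jpow_right (operatorCommute_mul_self a) m
  have h2 := (operatorCommute_mul_self a).symm.jpow_right (operatorCommute_refl (a * a)) m
  exact h1.symm.jpow_right h2.symm n

lemma jpow_mul_jpow (a : A) (m n : ℕ) : jpow a m * jpow a n = jpow a (m + n) := by
  induction m with
  | zero => simp [jpow]
  | succ m ih =>
    have h1 := (operatorCommute_refl a).jpow_right (operatorCommute_mul_self a) n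
    rw [Nat.add_right_comm]
    change (a * jpow a m) * jpow a n = a * jpow a (m + n)
    rw [← ih, mul_comm, ← h1.apply, mul_comm (jpow a n)]

lemma jpow_one (a : A) : jpow a 1 = a := mul_one a

lemma operatorCommute_jpow_of {a b : A} (h₁ : OperatorCommute b a)
    (h₂ : OperatorCommute b (a * a)) (m n : ℕ) : OperatorCommute (jpow b m) (jpow a n) := by
  have h : ∀ n, OperatorCommute b (jpow a n) := h₁.jpow_right h₂
  have h' : OperatorCommute (b * b) (jpow a n) :=
    (h n).mul_self_left (by rw [jpow_mul_jpow]; exact h _)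
  exact ((h n).symm.jpow_right h'.symm m).symm

/-- If `b` operator commutes with `a` and `a * a`, then the powers of `a` and of `b` together form
a pairwise operator commuting set that is closed under squares. -/
lemma exists_operatorCommute_set {a b : A} (h₁ : OperatorCommute b a)
    (h₂ : OperatorCommute b (a * a)) : ∃ S : Set A, (∀ s ∈ S, s * s ∈ S) ∧
      (∀ s ∈ S, ∀ t ∈ S, OperatorCommute s t) ∧ 1 ∈ S ∧ a ∈ S ∧ b ∈ S := by
  refine ⟨Set.range (jpow a) ∪ Set.range (jpow b), ?_, ?_, Or.inl ⟨0, rfl⟩,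
    Or.inl ⟨1, jpow_one a⟩, Or.inr ⟨1, jpow_one b⟩⟩
  · rintro _ (⟨n, rfl⟩ | ⟨n, rfl⟩)
    · exact Or.inl ⟨n + n, (jpow_mul_jpow a n n).symm⟩
    · exact Or.inr ⟨n + n, (jpow_mul_jpow b n n).symm⟩
  · rintro _ (⟨n, rfl⟩ | ⟨n, rfl⟩) _ (⟨m, rfl⟩ | ⟨m, rfl⟩)
    · exact operatorCommute_jpow_jpow a n m
    · exact (operatorCommute_jpow_of h₁ h₂ m n).symm
    · exact operatorCommute_jpow_of h₁ h₂ n m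
    · exact operatorCommute_jpow_jpow b n m

/-- Every element lies in a closed unital subalgebra of pairwise operator commuting elements. -/
lemma exists_closed_subalgebra (a : A) : ∃ B : NonUnitalSubalgebra ℝ A, IsClosed (B : Set A) ∧
    (∀ x ∈ B, ∀ y ∈ B, OperatorCommute x y) ∧ 1 ∈ B ∧ a ∈ B := by
  obtain ⟨S, hS, hc, h1, ha, -⟩ :=
    exists_operatorCommute_set (operatorCommute_refl a) (operatorCommute_mul_self a)
  exact ⟨bicommutant S hS, isClosed_bicommutant hS,
    fun x hx y hy => operatorCommute_of_mem_bicommutant hc hx hy, subset_bicommutant hS h1,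
    subset_bicommutant hS ha⟩

/-! ### The positive cone -/

lemma norm_one_le : ‖(1 : A)‖ ≤ 1 := by
  have h := norm_mul_self (1 : A)
  rw [mul_one] at h
  nlinarith [norm_nonneg (1 : A)]

/-- If `‖y‖ ≤ 1`, then `1 - y` has a square root. It is `1 - q`, where `q` is the limit of the
iteration `q ↦ (y + q * q) / 2`, which is dominated by the same iteration for the real number
`1`. -/
lemma exists_mem_mul_self_eq_one_sub {B : NonUnitalSubalgebra ℝ A} (hB : IsClosed (B : Set A))
    (h1 : 1 ∈ B) {y : A} (hyB : y ∈ B) (hy : ‖y‖ ≤ 1) : ∃ s ∈ B, s * s = 1 - y := by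
  let q : ℕ → A := fun n => Nat.rec 0 (fun _ q => (2⁻¹ : ℝ) • (y + q * q)) n
  let r : ℕ → ℝ := fun n => Nat.rec 0 (fun _ r => 2⁻¹ * (1 + r * r)) n
  have hq : ∀ n, q (n + 1) = (2⁻¹ : ℝ) • (y + q n * q n) := fun n => rfl
  have hr : ∀ n, r (n + 1) = 2⁻¹ * (1 + r n * r n) := fun n => rfl
  have hr01 : ∀ n, 0 ≤ r n ∧ r n ≤ 1 := by
    intro n
    induction n with
    | zero => exact ⟨le_rfl, zero_le_one⟩
    | succ n ih => rw [hr]; constructor <;> nlinarith [ih.1, ih.2]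
  have hqB : ∀ n, q n ∈ B := by
    intro n
    induction n with
    | zero => exact zero_mem B
    | succ n ih => rw [hq]; exact SMulMemClass.smul_mem _ (add_mem hyB (mul_mem ih ih))
  have hqr : ∀ n, ‖q n‖ ≤ r n := by
    intro n
    induction n with
    | zero => exact norm_zero.le
    | succ n ih =>
      rw [hq, hr, norm_smul, Real.norm_of_nonneg (by norm_num)]
      have := NonAssocNormedCommRing.norm_mul_le (q n) (q n)
      have h2 := mul_self_le_mul_self (norm_nonneg _) ih
      have h3 := norm_add_le y (q n * q n)
      gcongr
      linarith
  have hdiff : ∀ n, ‖q (n + 1) - q n‖ ≤ r (n + 1) - r n := by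
    intro n
    induction n with
    | zero =>
      have h := hqr 1
      change ‖q 1 - 0‖ ≤ r 1 - 0
      simpa using h
    | succ n ih =>
      have e1 : q (n + 1 + 1) - q (n + 1) =
          (2⁻¹ : ℝ) • ((q (n + 1) - q n) * (q (n + 1) + q n)) := by
        rw [hq (n + 1)]
        nth_rewrite 3 [hq n]
        rw [← smul_sub, sub_mul, mul_add, mul_add, mul_comm (q n) (q (n + 1))]
        congr 1
        abel
      rw [e1, norm_smul, Real.norm_of_nonneg (by norm_num)]
      have h2 := NonAssocNormedCommRing.norm_mul_le (q (n + 1) - q n) (q (n + 1) + q n)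
      have h3 : ‖q (n + 1) + q n‖ ≤ r (n + 1) + r n :=
        (norm_add_le _ _).trans (add_le_add (hqr (n + 1)) (hqr n))
      have h4 : ‖q (n + 1) - q n‖ * ‖q (n + 1) + q n‖ ≤ (r (n + 1) - r n) * (r (n + 1) + r n) := by
        gcongr
        linarith [norm_nonneg (q (n + 1) - q n)]
      rw [hr (n + 1)]
      nth_rewrite 2 [hr n]
      have e2 : 2⁻¹ * (1 + r (n + 1) * r (n + 1)) - 2⁻¹ * (1 + r n * r n) =
        2⁻¹ * ((r (n + 1) - r n) * (r (n + 1) + r n)) := by ring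
      rw [e2]
      gcongr
      exact h2.trans h4
  have hsum : Summable fun n => r (n + 1) - r n := by
    refine summable_of_sum_range_le (c := 1) (fun n => (norm_nonneg _).trans (hdiff n)) fun n => ?_
    rw [Finset.sum_range_sub]
    change r n - 0 ≤ 1
    linarith [(hr01 n).2]
  have hcauchy : CauchySeq q := cauchySeq_of_dist_le_of_summable _ (fun n => by
    rw [dist_comm, dist_eq_norm]; exact hdiff n) hsum
  obtain ⟨l, hl⟩ := cauchySeq_tendsto_of_complete hcauchy
  have hlB : l ∈ B := hB.mem_of_tendsto hl (Filter.Eventually.of_forall hqB)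
  have hfix : l = (2⁻¹ : ℝ) • (y + l * l) :=
    tendsto_nhds_unique (hl.comp (Filter.tendsto_add_atTop_nat 1))
      ((tendsto_const_nhds.add (hl.mul hl)).const_smul _)
  refine ⟨1 - l, sub_mem h1 hlB, ?_⟩
  have h2 : l + l = y + l * l := by
    nth_rewrite 1 [hfix]
    nth_rewrite 3 [hfix]
    rw [← add_smul]; norm_num
  rw [sub_mul, one_mul, mul_sub, mul_one, ← sub_eq_zero]
  rw [← sub_eq_zero] at h2
  rw [← neg_eq_zero, ← h2]
  abel

lemma isSquare_one_sub {y : A} (hy : ‖y‖ ≤ 1) : IsSquare (1 - y) := by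
  obtain ⟨s, -, hs⟩ := exists_mem_mul_self_eq_one_sub (B := ⊤) isClosed_univ
    (Set.mem_univ _) (Set.mem_univ y) hy
  exact ⟨s, hs.symm⟩

lemma isSquare_smul {x : A} (hx : IsSquare x) {c : ℝ} (hc : 0 ≤ c) : IsSquare (c • x) := by
  obtain ⟨y, rfl⟩ := hx
  refine ⟨√c • y, ?_⟩
  rw [smul_mul_smul_comm, Real.mul_self_sqrt hc]

lemma isSquare_of_norm_sub_le {x : A} {l : ℝ} (h : ‖l • (1 : A) - x‖ ≤ l) : IsSquare x := by
  rcases ((norm_nonneg _).trans h).eq_or_lt with rfl | hl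
  · simp at h
    exact ⟨0, by simp [h]⟩
  · have h1 : ‖l⁻¹ • (l • (1 : A) - x)‖ ≤ 1 := by
      rw [norm_smul, Real.norm_of_nonneg (by positivity), inv_mul_le_iff₀ hl, mul_one]
      exact h
    have h2 := isSquare_smul (isSquare_one_sub h1) hl.le
    rwa [smul_sub, smul_smul, mul_inv_cancel₀ hl.ne', one_smul, sub_sub_cancel] at h2

lemma norm_smul_one_sub_le {x : A} (hx : IsSquare x) {l : ℝ} (h : ‖x‖ ≤ l) :
    ‖l • (1 : A) - x‖ ≤ l := by
  rcases ((norm_nonneg _).trans h).eq_or_lt with rfl | hl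
  · simpa using h
  · have h1 : ‖l⁻¹ • x‖ ≤ 1 := by
      rw [norm_smul, Real.norm_of_nonneg (by positivity), inv_mul_le_iff₀ hl, mul_one]
      exact h
    obtain ⟨z, hz⟩ := isSquare_one_sub h1
    obtain ⟨y, hy⟩ := isSquare_smul hx (inv_nonneg.2 hl.le)
    have h2 := norm_mul_self_le z y
    rw [← hz, ← hy, sub_add_cancel] at h2
    have h3 : l • (1 : A) - x = l • (1 - l⁻¹ • x) := by
      rw [smul_sub, smul_smul, mul_inv_cancel₀ hl.ne', one_smul]
    rw [h3, norm_smul, Real.norm_of_nonneg hl.le]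
    nlinarith [h2.trans norm_one_le]

lemma isSquare_iff_norm {x : A} : IsSquare x ↔ ‖‖x‖ • (1 : A) - x‖ ≤ ‖x‖ :=
  ⟨fun h => norm_smul_one_sub_le h le_rfl, isSquare_of_norm_sub_le⟩

lemma isSquare_add {x y : A} (hx : IsSquare x) (hy : IsSquare y) : IsSquare (x + y) := by
  refine isSquare_of_norm_sub_le (l := ‖x‖ + ‖y‖) ?_
  rw [add_smul, add_sub_add_comm]
  exact (norm_add_le _ _).trans
    (add_le_add (norm_smul_one_sub_le hx le_rfl) (norm_smul_one_sub_le hy le_rfl))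

lemma isClosed_isSquare : IsClosed {x : A | IsSquare x} := by
  simp only [isSquare_iff_norm]
  exact isClosed_le (((continuous_norm.smul continuous_const).sub continuous_id).norm)
    continuous_norm

lemma isSquare_smul_one_add {z : A} {l : ℝ} (h : ‖z‖ ≤ l) : IsSquare (l • (1 : A) + z) :=
  isSquare_of_norm_sub_le (l := l) (by simpa using h)

/-- A positive element of norm at most one dominates its square: in a closed subalgebra of operator
commuting elements containing a square root `y` of `x`, the element `x - x * x` is the square of
`y * z`, where `z * z = 1 - x`. -/
lemma isSquare_sub_mul_self {x : A} (hx : IsSquare x) (h : ‖x‖ ≤ 1) : IsSquare (x - x * x) := by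
  obtain ⟨y, rfl⟩ := hx
  obtain ⟨B, hB, hc, h1, hy⟩ := exists_closed_subalgebra y
  obtain ⟨z, hz, hzz⟩ := exists_mem_mul_self_eq_one_sub hB h1 (mul_mem hy hy) h
  refine ⟨y * z, ?_⟩
  have e1 : y * y - y * y * (y * y) = (z * z) * (y * y) := by
    rw [hzz, sub_mul, one_mul]
  have e2 := (hc _ (mul_mem hz hz) _ hy).apply y
  have e3 := (hc _ (mul_mem hy hz) _ hy).apply z
  rw [e1, e2, e3, mul_comm (z * z) y, mul_comm (y * z) z, (hc _ hz _ hy).apply]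

end JBAlgebra

section

open Filter Topology Set

namespace JBAlgebra

variable {A : Type*} [JBAlgebra A]

/-! ### Positive functionals and the boundary of the cone -/

/-- The Cauchy–Schwarz inequality in the degenerate case. -/
lemma apply_mul_eq_zero_of_apply_mul_self {ω : A →ₗ[ℝ] ℝ} (hω : ∀ x, IsSquare x → 0 ≤ ω x) {x : A}
    (hx : ω (x * x) = 0) (z : A) : ω (x * z) = 0 := by
  have h : ∀ t : ℝ, 0 ≤ 2 * t * ω (x * z) + ω (z * z) := by
    intro t
    have h1 := hω _ ⟨t • x + z, rfl⟩
    have h2 : (t • x + z) * (t • x + z) = (t * t) • (x * x) + (2 * t) • (x * z) + z * z := by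
      rw [add_mul, mul_add, mul_add, smul_mul_smul_comm, smul_mul_assoc, mul_smul_comm,
        mul_comm z x, two_mul, add_smul]
      abel
    rw [h2] at h1
    simpa [hx] using h1
  by_contra hne
  have h3 := h (-(ω (z * z) + 1) / (2 * ω (x * z)))
  have h4 : 2 * (-(ω (z * z) + 1) / (2 * ω (x * z))) * ω (x * z) = -(ω (z * z) + 1) := by
    field_simp
  linarith

/-- If a positive functional annihilates a positive element `x`, then it annihilates all
multiples of `x`. -/
lemma apply_mul_eq_zero {ω : A →ₗ[ℝ] ℝ} (hω : ∀ x, IsSquare x → 0 ≤ ω x) {x : A}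
    (hx : IsSquare x) (h0 : ω x = 0) (z : A) : ω (x * z) = 0 := by
  have hl : 0 < ‖x‖ + 1 := by positivity
  set u : A := (‖x‖ + 1)⁻¹ • x with hu
  have hu1 : ‖u‖ ≤ 1 := by
    rw [hu, norm_smul, Real.norm_of_nonneg (by positivity), inv_mul_le_iff₀ hl]
    linarith
  have hus : IsSquare u := isSquare_smul hx (by positivity)
  have h1 := hω _ (isSquare_sub_mul_self hus hu1)
  have h2 := hω _ ⟨u, rfl⟩
  have h3 : ω u = 0 := by rw [hu, map_smul, h0, smul_zero]
  rw [map_sub, h3] at h1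
  have h4 := apply_mul_eq_zero_of_apply_mul_self hω (le_antisymm (by linarith) h2) z
  rw [hu, smul_mul_assoc, map_smul, smul_eq_mul, mul_eq_zero] at h4
  exact h4.resolve_left (by positivity)

variable (A) in
/-- The interior of the positive cone: the elements that dominate a positive multiple of `1`. -/
def posInterior : Set A := {y | ∃ ε > (0 : ℝ), IsSquare (y - ε • (1 : A))}

lemma isOpen_posInterior : IsOpen (posInterior A) := by
  refine Metric.isOpen_iff.2 ?_
  rintro y ⟨ε, hε, hy⟩
  refine ⟨ε / 2, by positivity, fun z hz => ⟨ε / 2, by positivity, ?_⟩⟩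
  rw [mem_ball_iff_norm] at hz
  have h := isSquare_add hy (isSquare_smul_one_add hz.le)
  have e : y - ε • (1 : A) + ((ε / 2) • (1 : A) + (z - y)) = z - (ε / 2) • (1 : A) := by
    have : ε • (1 : A) = (ε / 2) • (1 : A) + (ε / 2) • (1 : A) := by rw [← add_smul, add_halves]
    rw [this]
    abel
  rwa [e] at h

lemma convex_posInterior : Convex ℝ (posInterior A) := by
  rintro y ⟨ε, hε, hy⟩ z ⟨δ, hδ, hz⟩ a b ha hb hab
  refine ⟨a * ε + b * δ, ?_, ?_⟩
  · rcases ha.eq_or_lt with rfl | ha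
    · rw [zero_add] at hab
      subst hab
      linarith
    · positivity
  · have h := isSquare_add (isSquare_smul hy ha) (isSquare_smul hz hb)
    have e : a • (y - ε • (1 : A)) + b • (z - δ • (1 : A)) =
        a • y + b • z - (a * ε + b * δ) • (1 : A) := by
      rw [smul_sub, smul_sub, smul_smul, smul_smul, add_smul]
      abel
    rwa [e] at h

lemma add_smul_one_mem_posInterior {x : A} (hx : IsSquare x) {ε : ℝ} (hε : 0 < ε) :
    x + ε • (1 : A) ∈ posInterior A := ⟨ε, hε, by rwa [add_sub_cancel_right]⟩

lemma isSquare_of_mem_posInterior {x : A} (hx : x ∈ posInterior A) : IsSquare x := by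
  obtain ⟨ε, hε, h⟩ := hx
  have h1 : IsSquare (ε • (1 : A)) := isSquare_smul ⟨1, (mul_one 1).symm⟩ hε.le
  simpa using isSquare_add h h1

/-- At each boundary point of the positive cone there is a supporting positive functional. -/
lemma exists_positive_functional {x : A} (hx : IsSquare x) (hx' : x ∉ posInterior A) :
    ∃ ω : A →L[ℝ] ℝ, (∀ y, IsSquare y → 0 ≤ ω y) ∧ 0 < ω 1 ∧ ω x = 0 := by
  obtain ⟨f, hf⟩ := geometric_hahn_banach_open_point convex_posInterior isOpen_posInterior hx'
  have h : ∀ p, IsSquare p → ∀ n δ : ℝ, 0 ≤ n → 0 < δ → n * f p + δ * f 1 < f x := by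
    intro p hp n δ hn hδ
    simpa using hf _ (add_smul_one_mem_posInterior (isSquare_smul hp hn) hδ)
  have hpos : ∀ p, IsSquare p → f p ≤ 0 := by
    intro p hp
    by_contra! hlt
    have h1 := h p hp ((|f x - f 1| + 1) / f p) 1 (by positivity) one_pos
    rw [div_mul_cancel₀ _ hlt.ne'] at h1
    have := le_abs_self (f x - f 1)
    linarith
  have hfx := hpos x hx
  have hf1 : f 1 < 0 := by
    have := h x hx 0 1 le_rfl one_pos
    linarith
  have hfx0 : f x = 0 := by
    refine le_antisymm hfx ?_
    by_contra! hlt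
    have h1 := h x hx 0 (f x / (2 * f 1)) le_rfl
      (div_pos_of_neg_of_neg hlt (by linarith))
    have hne := hf1.ne
    have h2 : f x / (2 * f 1) * f 1 = f x / 2 := by field_simp
    linarith
  exact ⟨-f, fun y hy => by simpa using hpos y hy, by simpa using hf1, by simpa using hfx0⟩

/-- A differentiable path that starts in the interior of the positive cone and points strictly
inwards whenever it touches the boundary never leaves the interior. -/
lemma mem_posInterior_of_hasDerivAt {y y' : ℝ → A} (hd : ∀ t, HasDerivAt y (y' t) t)
    (h0 : y 0 ∈ posInterior A)
    (H : ∀ t ∈ Icc (0 : ℝ) 1, ∀ ω : A →L[ℝ] ℝ, (∀ y, IsSquare y → 0 ≤ ω y) → 0 < ω 1 →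
      IsSquare (y t) → ω (y t) = 0 → 0 < ω (y' t)) : y 1 ∈ posInterior A := by
  have hcont : Continuous y := continuous_iff_continuousAt.2 fun t => (hd t).continuousAt
  by_contra h1
  have hK : IsCompact (Icc (0 : ℝ) 1 ∩ y ⁻¹' (posInterior A)ᶜ) :=
    isCompact_Icc.inter_right (isOpen_posInterior.isClosed_compl.preimage hcont)
  obtain ⟨t, ⟨ht, hyt⟩, hmin⟩ := hK.exists_isLeast ⟨1, ⟨by simp, h1⟩⟩
  have ht0 : 0 < t := by
    refine ht.1.lt_of_ne ?_
    rintro rfl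
    exact hyt h0
  have hsq : ∀ᶠ s in 𝓝[<] t, IsSquare (y s) := by
    filter_upwards [Ioo_mem_nhdsLT ht0] with s hs
    by_contra hns
    have := hmin ⟨⟨hs.1.le, hs.2.le.trans ht.2⟩, fun h => hns (isSquare_of_mem_posInterior h)⟩
    exact absurd hs.2 (not_lt.2 this)
  have hyt' : IsSquare (y t) :=
    isClosed_isSquare.mem_of_tendsto (hcont.continuousAt.mono_left nhdsWithin_le_nhds) hsq
  obtain ⟨ω, hω, hω1, hω0⟩ := exists_positive_functional hyt' hyt
  have hpos := H t ht ω hω hω1 hyt' hω0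
  have hder : HasDerivAt (fun s => ω (y s)) (ω (y' t)) t :=
    ω.hasFDerivAt.comp_hasDerivAt t (hd t)
  have hslope := (hasDerivWithinAt_iff_tendsto_slope' (s := Iio t) (by simp)).1
    hder.hasDerivWithinAt
  have hle : ω (y' t) ≤ 0 := by
    refine le_of_tendsto hslope ?_
    filter_upwards [hsq, self_mem_nhdsWithin] with s hs hst
    rw [slope_def_field, hω0, sub_zero]
    exact div_nonpos_of_nonneg_of_nonpos (hω _ hs) (sub_nonpos.2 (le_of_lt hst))
  exact absurd hpos (not_lt.2 hle)

/-! ### Quadratic maps -/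

/-- The quadratic map `U_c : x ↦ 2 c (c x) - c ^ 2 x`. -/
noncomputable def quad (c : A) : A →L[ℝ] A := (2 : ℝ) • (mulL c * mulL c) - mulL (c * c)

lemma quad_apply (c x : A) : quad c x = (2 : ℝ) • (c * (c * x)) - c * c * x := rfl

lemma quad_one_add_smul (c x : A) (t : ℝ) :
    quad (1 + t • c) x = x + (2 * t) • (c * x) + t ^ 2 • quad c x := by
  simp only [quad_apply, add_mul, mul_add, one_mul, mul_one, smul_mul_assoc, mul_smul_comm,
    smul_add, smul_sub, smul_smul]
  module

/-- The Neumann series, in a closed unital subalgebra. -/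
lemma exists_inverse {B : NonUnitalSubalgebra ℝ A} (hB : IsClosed (B : Set A)) (h1 : 1 ∈ B)
    {c : A} (hc : c ∈ B) (hc1 : ‖c‖ < 1) :
    ∃ e ∈ B, e * (1 + c) = 1 ∧ (1 - ‖c‖) * ‖e‖ ≤ 1 := by
  let f : A → A := fun x => 1 - c * x
  have hf : ContractingWith ‖c‖₊ f := by
    refine ⟨hc1, LipschitzWith.of_dist_le_mul fun x y => ?_⟩
    rw [dist_eq_norm, dist_eq_norm]
    have e : f x - f y = c * (y - x) := by simp only [f, mul_sub]; abel
    rw [e, norm_sub_rev x y]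
    exact NonAssocNormedCommRing.norm_mul_le _ _
  set e := ContractingWith.fixedPoint f hf with he
  have hfix : 1 - c * e = e := hf.fixedPoint_isFixedPt
  have heB : e ∈ B := by
    refine hB.mem_of_tendsto (hf.tendsto_iterate_fixedPoint 0) (Eventually.of_forall fun n => ?_)
    induction n with
    | zero => exact zero_mem B
    | succ n ih =>
      rw [Function.iterate_succ_apply']
      exact sub_mem h1 (mul_mem hc ih)
  refine ⟨e, heB, ?_, ?_⟩
  · rw [mul_add, mul_one, mul_comm e c]
    nth_rewrite 1 [← hfix]
    rw [sub_add_cancel]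
  · have h2 : ‖e‖ ≤ 1 + ‖c‖ * ‖e‖ := by
      calc ‖e‖ = ‖1 - c * e‖ := by rw [hfix]
        _ ≤ ‖(1 : A)‖ + ‖c * e‖ := norm_sub_le _ _
        _ ≤ _ := add_le_add norm_one_le (NonAssocNormedCommRing.norm_mul_le _ _)
    linarith

/-- In a subalgebra of operator commuting elements, `T_d U_p = 2 T_{d p} T_p - T_{p (d p)}`. -/
lemma mul_quad {B : NonUnitalSubalgebra ℝ A} (hB : ∀ x ∈ B, ∀ y ∈ B, OperatorCommute x y)
    {d p : A} (hd : d ∈ B) (hp : p ∈ B) (x : A) :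
    d * quad p x = (2 : ℝ) • (d * p * (p * x)) - p * (d * p) * x := by
  have h := mul_mul_mul_eq d p p x
  have e1 : p * p * d = p * (d * p) := by
    rw [mul_comm (p * p) d, (hB d hd p hp).apply]
  rw [e1, ← (hB d hd _ (mul_mem hp hp)).apply, ← (hB d hd p hp).apply (p * x), mul_comm p d] at h
  rw [quad_apply, mul_sub, mul_smul_comm, h]
  module

lemma quad_quad_of_mul_eq_one {B : NonUnitalSubalgebra ℝ A}
    (hB : ∀ x ∈ B, ∀ y ∈ B, OperatorCommute x y) {e p : A} (he : e ∈ B) (hp : p ∈ B)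
    (h1 : e * p = 1) (x : A) : quad e (quad p x) = x := by
  have h2 : e * e * p = e := by
    rw [mul_comm (e * e), (hB _ hp _ he).apply, mul_comm p e, h1, mul_one]
  have h3 := mul_quad hB he hp x
  have h4 := mul_quad hB (mul_mem he he) hp x
  rw [h1, one_mul, mul_one] at h3
  rw [h2, mul_comm p e, h1, one_mul] at h4
  rw [quad_apply e, h3, h4]
  simp only [mul_sub, mul_smul_comm]
  module

/-- For small `c` the map `U_{1 + c}` is positive. The path `t ↦ U_{1 + t c} x` satisfies
`y' = 2 T_d y` with `d = (1 + t c)⁻¹ c`, and positive functionals that annihilate a positive element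
`y` annihilate `d y`; the perturbation `ε (1 + t)` makes the path point strictly inwards at the
boundary. -/
lemma isSquare_quad_one_add {c : A} (hc : ‖c‖ ≤ 1 / 8) {x : A} (hx : IsSquare x) :
    IsSquare (quad (1 + c) x) := by
  obtain ⟨B, hBc, hB, h1, hcB⟩ := exists_closed_subalgebra c
  have key : ∀ ε : ℝ, 0 < ε → IsSquare (quad (1 + c) x + (2 * ε) • (1 : A)) := by
    intro ε hε
    let y : ℝ → A := fun t => x + t • ((2 : ℝ) • (c * x)) + t ^ 2 • quad c x + (1 + t) • ε • (1 : A)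
    let y' : ℝ → A := fun t => (2 : ℝ) • (c * x) + (2 * t) • quad c x + ε • (1 : A)
    have hyq : ∀ t, y t = quad (1 + t • c) x + (1 + t) • ε • (1 : A) := by
      intro t
      simp only [y, quad_one_add_smul]
      module
    have hd : ∀ t, HasDerivAt y (y' t) t := by
      intro t
      have e1 : HasDerivAt (fun t : ℝ => t • ((2 : ℝ) • (c * x))) ((1 : ℝ) • (2 : ℝ) • (c * x)) t :=
        (hasDerivAt_id t).smul_const _
      have e2 : HasDerivAt (fun t : ℝ => t ^ 2 • quad c x) ((2 * t) • quad c x) t := by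
        simpa using (hasDerivAt_pow 2 t).smul_const (quad c x)
      have e3 : HasDerivAt (fun t : ℝ => (1 + t) • ε • (1 : A)) ((1 : ℝ) • ε • (1 : A)) t :=
        ((hasDerivAt_id t).const_add 1).smul_const _
      refine (((e1.const_add x).add e2).add e3).congr_deriv ?_
      simp [y']
    have hmem := mem_posInterior_of_hasDerivAt hd
      (by simpa [y] using add_smul_one_mem_posInterior hx hε) (by
        intro t ht ω hω hω1 hsq h0
        have htc : ‖t • c‖ ≤ 1 / 8 := by
          rw [norm_smul, Real.norm_of_nonneg ht.1]
          nlinarith [ht.1, ht.2, norm_nonneg c]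
        have htB : t • c ∈ B := B.toSubmodule.smul_mem t hcB
        obtain ⟨e, heB, he1, hen⟩ := exists_inverse hBc h1 htB (by linarith)
        set p := 1 + t • c with hp
        have hpB : p ∈ B := add_mem h1 htB
        set d := c * e with hddef
        have hdB : d ∈ B := mul_mem hcB heB
        have hdp : d * p = c := by
          rw [hddef, mul_comm, mul_comm c e, mul_comm e c, (hB p hpB c hcB).apply, mul_comm p e,
            he1, mul_one]
        have hdn : ‖d‖ ≤ 1 / 7 := by
          have := NonAssocNormedCommRing.norm_mul_le c e
          nlinarith [norm_nonneg e, norm_nonneg c]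
        have hy' : y' t = (2 : ℝ) • (y t * d) + (ε • (1 : A) - (2 * (1 + t) * ε) • d) := by
          have h2 := mul_quad hB hdB hpB x
          rw [hdp] at h2
          rw [mul_comm, hyq, mul_add, ← hp, h2]
          simp only [y', hp, quad_apply, add_mul, mul_add, one_mul, mul_one, smul_mul_assoc,
            mul_smul_comm, smul_add, smul_sub, smul_smul]
          module
        have h3 : ω (y t * d) = 0 := apply_mul_eq_zero (ω := (ω : A →ₗ[ℝ] ℝ)) hω hsq h0 d
        have h4 : ω d ≤ 1 / 7 * ω 1 := by
          have := hω _ (isSquare_smul_one_add (z := -d) (l := 1 / 7) (by rwa [norm_neg]))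
          simp only [map_add, map_smul, map_neg, smul_eq_mul] at this
          linarith
        rw [hy', map_add, map_smul, h3, map_sub, map_smul, map_smul]
        simp only [smul_eq_mul, mul_zero, zero_add]
        have h5 : (2 * (1 + t) * ε) * ω d ≤ (2 * (1 + t) * ε) * (1 / 7 * ω 1) := by
          have := ht.1
          gcongr
        have h6 : 0 < ε * ω 1 := by positivity
        nlinarith [ht.2])
    have h2 := isSquare_of_mem_posInterior hmem
    rw [hyq, one_smul] at h2
    convert h2 using 2
    module
  have hlim : Tendsto (fun ε : ℝ => quad (1 + c) x + (2 * ε) • (1 : A)) (𝓝[>] 0)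
      (𝓝 (quad (1 + c) x)) := by
    have hcont : Continuous fun ε : ℝ => quad (1 + c) x + (2 * ε) • (1 : A) := by fun_prop
    have := hcont.tendsto 0
    simp only [mul_zero, zero_smul, add_zero] at this
    exact this.mono_left nhdsWithin_le_nhds
  exact isClosed_isSquare.mem_of_tendsto hlim (by
    filter_upwards [self_mem_nhdsWithin] with ε hε using key ε hε)

/-- For small `c` the map `U_{1 + c}` is an order isomorphism, with inverse `U_{(1 + c)⁻¹}`. The
bound on `c` ensures that `isSquare_quad_one_add` applies to `(1 + c)⁻¹` too. -/
lemma exists_inverse_quad {c : A} (hc : ‖c‖ ≤ 1 / 9) : ∃ V : A →L[ℝ] A,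
    (∀ x, IsSquare x → IsSquare (V x)) ∧ (∀ x, V (quad (1 + c) x) = x) ∧
      ∀ x, quad (1 + c) (V x) = x := by
  obtain ⟨B, hBc, hB, h1, hcB⟩ := exists_closed_subalgebra c
  obtain ⟨e, heB, he1, hen⟩ := exists_inverse hBc h1 hcB (by linarith)
  have hpB : 1 + c ∈ B := add_mem h1 hcB
  refine ⟨quad e, fun x hx => ?_, quad_quad_of_mul_eq_one hB heB hpB he1,
    quad_quad_of_mul_eq_one hB hpB heB (by rwa [mul_comm])⟩
  have he : e = 1 + (-(e * c)) := by
    rw [← he1, mul_add, mul_one]; abel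
  rw [he]
  -- `‖e * c‖ ≤ ‖c‖ / (1 - ‖c‖) ≤ (1 / 9) / (8 / 9) = 1 / 8`
  refine isSquare_quad_one_add ?_ hx
  rw [norm_neg]
  have := NonAssocNormedCommRing.norm_mul_le e c
  nlinarith [norm_nonneg e, norm_nonneg c]

end JBAlgebra

end

section

open scoped Topology

namespace JBAlgebra

variable {A : Type*} [JBAlgebra A]

/-! ### Weak continuity of the multiplication -/

/-- Positive bijections with positive inverse preserve normal states under composition. -/
lemma IsNormalState.comp {ω : Module.Dual ℝ A} (hω : IsNormalState ω) {U V : A →L[ℝ] A}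
    (hU : ∀ x, IsSquare x → IsSquare (U x)) (hV : ∀ x, IsSquare x → IsSquare (V x))
    (hVU : ∀ x, V (U x) = x) (hUV : ∀ x, U (V x) = x) :
    IsNormalState (ω ∘ₗ (U : A →ₗ[ℝ] A)) where
  nonneg a ha := hω.nonneg _ (hU a ha)
  normal S s hne hdir hsup := by
    have hUle : ∀ {x y : A}, Le x y → Le (U x) (U y) := fun {x y} h => by
      have := hU _ h
      rwa [map_sub] at this
    have hVle : ∀ {x y : A}, Le x y → Le (V x) (V y) := fun {x y} h => by
      have := hV _ h
      rwa [map_sub] at this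
    have h := hω.normal (U '' S) (U s) (hne.image U) ?_ ⟨?_, ?_⟩
    · rw [Set.image_image] at h
      exact h
    · rintro _ ⟨x, hx, rfl⟩ _ ⟨y, hy, rfl⟩
      obtain ⟨z, hz, hxz, hyz⟩ := hdir x hx y hy
      exact ⟨U z, ⟨z, hz, rfl⟩, hUle hxz, hUle hyz⟩
    · rintro _ ⟨x, hx, rfl⟩
      exact hUle (hsup.1 x hx)
    · intro u hu
      have h1 : Le s (V u) := hsup.2 _ fun x hx => by
        have := hVle (hu _ ⟨x, hx, rfl⟩)
        rwa [hVU] at this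
      have := hUle h1
      rwa [hUV] at this

lemma IsNormalState.comp_quad {ω : Module.Dual ℝ A} (hω : IsNormalState ω) {c : A}
    (hc : ‖c‖ ≤ 1 / 9) : IsNormalState (ω ∘ₗ (quad (1 + c) : A →ₗ[ℝ] A)) := by
  obtain ⟨V, hV, hVU, hUV⟩ := exists_inverse_quad hc
  exact hω.comp (fun x hx => isSquare_quad_one_add (by linarith) hx) hV hVU hUV

/-- Multiplication operators are weakly continuous, because `T_c` is a linear combination of
`U_{1 + 2 c}`, `U_{1 + c}` and the identity. -/
lemma comp_mulLeft_mem_normalDual {ω : Module.Dual ℝ A} (hω : ω ∈ normalDual A) (c : A) :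
    ω ∘ₗ LinearMap.mulLeft ℝ c ∈ normalDual A := by
  have small : ∀ ω : Module.Dual ℝ A, IsNormalState ω → ∀ c : A, ‖c‖ ≤ 1 / 18 →
      ω ∘ₗ LinearMap.mulLeft ℝ c ∈ normalDual A := by
    intro ω hω c hc
    have h2c : ‖(2 : ℝ) • c‖ ≤ 1 / 9 := by
      rw [norm_smul, Real.norm_of_nonneg (by norm_num)]
      linarith
    have e : ω ∘ₗ LinearMap.mulLeft ℝ c =
        (-(1 / 4) : ℝ) • (ω ∘ₗ (quad (1 + (2 : ℝ) • c) : A →ₗ[ℝ] A)) +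
        ω ∘ₗ (quad (1 + c) : A →ₗ[ℝ] A) - (3 / 4 : ℝ) • ω := by
      ext x
      have h1 := quad_one_add_smul c x 1
      rw [one_smul] at h1
      simp only [LinearMap.comp_apply, LinearMap.sub_apply, LinearMap.add_apply,
        LinearMap.smul_apply, ContinuousLinearMap.coe_coe, LinearMap.mulLeft_apply,
        quad_one_add_smul, h1, map_add, map_smul, smul_eq_mul]
      ring
    rw [e]
    exact sub_mem (add_mem (Submodule.smul_mem _ _ (Submodule.subset_span (hω.comp_quad h2c)))
      (Submodule.subset_span (hω.comp_quad (by linarith))))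
      (Submodule.smul_mem _ _ (Submodule.subset_span hω))
  have state : ∀ ω : Module.Dual ℝ A, IsNormalState ω →
      ω ∘ₗ LinearMap.mulLeft ℝ c ∈ normalDual A := by
    intro ω hω
    have hl : 0 < 18 * (‖c‖ + 1) := by positivity
    have h := small ω hω ((18 * (‖c‖ + 1))⁻¹ • c) (by
      rw [norm_smul, Real.norm_of_nonneg (by positivity), inv_mul_le_iff₀ hl]
      linarith)
    have h2 := Submodule.smul_mem _ (18 * (‖c‖ + 1)) h
    convert h2 using 1
    ext x
    simp only [LinearMap.comp_apply, LinearMap.smul_apply, LinearMap.mulLeft_apply,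
      smul_mul_assoc, map_smul, smul_smul]
    rw [mul_inv_cancel₀ hl.ne', one_smul]
  induction hω using Submodule.span_induction with
  | mem ω hω => exact state ω hω
  | zero => simp
  | add f g _ _ hf hg => rw [LinearMap.add_comp]; exact add_mem hf hg
  | smul r f _ hf => rw [LinearMap.smul_comp]; exact Submodule.smul_mem _ _ hf

lemma apply_eq_zero_of_mem_weakClosure {S : Set A} {ψ : Module.Dual ℝ A} (hψ : ψ ∈ normalDual A)
    (h : ∀ x ∈ S, ψ x = 0) {x : A} (hx : x ∈ @closure A (weakTopology A) S) : ψ x = 0 := by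
  have hle : weakTopology A ≤ TopologicalSpace.induced (fun a : A => ψ a) inferInstance :=
    iInf₂_le ψ hψ
  have hcl : @IsClosed A (weakTopology A) {x | ψ x = 0} :=
    (isClosed_induced_iff.2 ⟨{0}, isClosed_singleton, rfl⟩ :
      IsClosed[TopologicalSpace.induced (fun a : A => ψ a) inferInstance] {x | ψ x = 0}).mono hle
  have hsub : @closure A (weakTopology A) S ⊆ {x | ψ x = 0} :=
    @closure_minimal A (weakTopology A) _ _ (fun x hx => h x hx) hcl
  exact hsub hx

end JBAlgebra

namespace JBWAlgebra

open JBAlgebra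

variable {A : Type*} [JBWAlgebra A]

/-- Commutants are weakly closed, since the normal states separate points and multiplications are
weakly continuous. -/
lemma weakClosure_subset_commutant {S T : Set A} (hS : S ⊆ (commutant T : Set A)) :
    @closure A (weakTopology A) S ⊆ (commutant T : Set A) := by
  intro x hx s hs
  refine operatorCommute_iff.2 fun z => JBWAlgebra.eq_of_normalState _ _ fun ω hω => ?_
  have hω' : ω ∈ normalDual A := Submodule.subset_span hω
  have hψ : ω ∘ₗ LinearMap.mulLeft ℝ (s * z) - (ω ∘ₗ LinearMap.mulLeft ℝ s) ∘ₗ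
      LinearMap.mulLeft ℝ z ∈ normalDual A :=
    sub_mem (comp_mulLeft_mem_normalDual hω' _)
      (comp_mulLeft_mem_normalDual (comp_mulLeft_mem_normalDual hω' s) z)
  have h := apply_eq_zero_of_mem_weakClosure hψ (fun y hy => by
    change ω (s * z * y) - ω (s * (z * y)) = 0
    rw [mul_comm _ y, mul_comm z y, (hS hy s hs).apply, sub_self]) hx
  change ω (s * z * x) - ω (s * (z * x)) = 0 at h
  rw [mul_comm _ x, mul_comm z x] at h
  exact sub_eq_zero.1 h

lemma W_subset_bicommutant {S : Set A} (hS : ∀ s ∈ S, s * s ∈ S) (h1 : 1 ∈ S) {a : A}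
    (ha : a ∈ S) : W a ⊆ (bicommutant S hS : Set A) := by
  have hJ : J a ≤ bicommutant S hS := NonUnitalAlgebra.adjoin_le <| by
    rintro _ (rfl | rfl)
    · exact subset_bicommutant hS h1
    · exact subset_bicommutant hS ha
  exact weakClosure_subset_commutant (closure_minimal hJ (isClosed_bicommutant hS))

end JBWAlgebra

end

theorem mainTheorem11 {A : Type*} [JBWAlgebra A] (a b : A)
    (h₁ : JBAlgebra.OperatorCommute b a) (h₂ : JBAlgebra.OperatorCommute b (a * a)) :
    JBAlgebra.OperatorCommute (b * b) a ∧
      ∃ B : NonUnitalSubalgebra ℝ A,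
        (∀ x ∈ B, ∀ y ∈ B, ∀ z ∈ B, (x * y) * z = x * (y * z)) ∧
        (∀ x ∈ B, ∀ y ∈ B, JBAlgebra.OperatorCommute x y) ∧
        JBAlgebra.W a ⊆ (B : Set A) ∧ JBAlgebra.W b ⊆ (B : Set A) := by
  refine ⟨h₁.mul_self_left h₂, ?_⟩
  obtain ⟨S, hS, hc, h1, ha, hb⟩ := JBAlgebra.exists_operatorCommute_set h₁ h₂
  have hB : ∀ x ∈ JBAlgebra.bicommutant S hS, ∀ y ∈ JBAlgebra.bicommutant S hS,
      JBAlgebra.OperatorCommute x y :=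
    fun x hx y hy => JBAlgebra.operatorCommute_of_mem_bicommutant hc hx hy
  refine ⟨JBAlgebra.bicommutant S hS, fun x hx y _ z hz => ?_, hB,
    JBWAlgebra.W_subset_bicommutant hS h1 ha, JBWAlgebra.W_subset_bicommutant hS h1 hb⟩
  rw [mul_comm (x * y) z, (hB z hz x hx).apply, mul_comm z y]
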